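/- Let $H_n$ be the physicists' Hermite polynomials ($H_0=1$, $H_{n+1}(x)=2xH_n(x)-H_n'(x)$) and let $$e_n(x)=\frac{1}{\sqrt{2^n\,n!\,\sqrt{\pi}}}\,H_n(x)\,e^{-x^2/2},\qquad n=0,1,2,\dots,$$ be the Hermite functions, i.e. the standard orthonormal basis of $L^2(\mathbb{R})$ consisting of eigenfunctions of the harmonic oscillator. They are real-valued Schwartz functions. For tempered distributions $F,G\in\mathcal{S}'(\mathbb{R})$ the $e$-product $\langle F,G\rangle_e$ is said to exist if the series $$\langle F,G\rangle_e=\sum_{n=0}^\infty \overline{F[e_n]}\;G[e_n]$$ converges (as the limit of its partial sums); its value is then the sum. Regard $\cos x$ and $\sin x$ as tempered distributions, $\varphi\mapsto\int_{\mathbb{R}}\varphi(x)\cos x\,dx$ and $\varphi\mapsto\int_{\mathbb{R}}\varphi(x)\sin x\,dx$, and let $\delta$ be the Dirac distribution at $0$, $\delta[\varphi]=\varphi(0)$. Then: 1. For all $l\ge 0$, $$\int_{\mathbb{R}}\cos(x)\,e_{2l+1}(x)\,dx=0,\qquad \int_{\mathbb{R}}\cos(x)\,e_{2l}(x)\,dx=\sqrt{\frac{\sqrt{\pi}}{2^{2l-1}\,(2l)!\,e}}\;(-1)^l\,H_{2l}(1).$$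 2. The following series converges (as the limit of its partial sums), with the stated sum: $$\sum_{l=0}^\infty\frac{(-i)^l}{2^l\,l!}\,H_l(1)\,H_l(0)=\sqrt{\frac{e}{2}}.$$ 3. The $e$-product of $\cos x$ and $\delta$ exists and $\langle \cos x,\delta\rangle_e=1$, which agrees with $\int_{\mathbb{R}}\cos(x)\,\delta(x)\,dx=1$ (the integral of $\cos$ against the unit point mass at $0$). 4. The $e$-product of $\sin x$ and $\delta$ exists and $\langle \sin x,\delta\rangle_e=0$, which agrees with $\int_{\mathbb{R}}\sin(x)\,\delta(x)\,dx=0$. -/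

import Mathlib

open MeasureTheory Filter Topology SchwartzMap
open scoped Nat ContDiff

/-- The physicists' Hermite polynomials `H_n`:
`H_0 = 1` and `H_{n+1}(x) = 2 x H_n(x) - H_n'(x)`. -/
noncomputable def physHermite : ℕ → Polynomial ℝ
  | 0 => 1
  | n + 1 => 2 * Polynomial.X * physHermite n - Polynomial.derivative (physHermite n)

/-! ### Polynomials times the Gaussian are Schwartz functions -/

/-- A polynomial times `exp (-x ^ 2 / 2)` is bounded. -/
theorem polyGaussian_bounded (p : Polynomial ℝ) :
    ∃ C : ℝ, ∀ x : ℝ, |p.eval x * Real.exp (-x ^ 2 / 2)| ≤ C := by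
  induction p using Polynomial.induction_on' with
  | add p q hp hq =>
    obtain ⟨C, hC⟩ := hp
    obtain ⟨D, hD⟩ := hq
    refine ⟨C + D, fun x => ?_⟩
    rw [Polynomial.eval_add, add_mul]
    exact (abs_add_le _ _).trans (add_le_add (hC x) (hD x))
  | monomial m a =>
    refine ⟨|a| * (1 + 2 ^ m * m !), fun x => ?_⟩
    have h1 : |x| ^ m ≤ 1 + x ^ (2 * m) := by
      have : x ^ (2 * m) = (|x| ^ m) ^ 2 := by
        rw [← pow_mul, mul_comm m 2, pow_mul, pow_mul, sq_abs]
      rw [this]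
      nlinarith [sq_nonneg (|x| ^ m - 1)]
    have h2 : x ^ (2 * m) * Real.exp (-x ^ 2 / 2) ≤ 2 ^ m * m ! := by
      have h := Real.pow_div_factorial_le_exp (x ^ 2 / 2) (by positivity) m
      have hm : (0 : ℝ) < m ! := by positivity
      rw [div_le_iff₀ hm, div_pow, ← pow_mul, div_le_iff₀ (by positivity)] at h
      have he : -x ^ 2 / 2 = -(x ^ 2 / 2) := by ring
      rw [he, Real.exp_neg, ← div_eq_mul_inv, div_le_iff₀ (Real.exp_pos _)]
      linarith
    have h3 : Real.exp (-x ^ 2 / 2) ≤ 1 := by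
      rw [Real.exp_le_one_iff]
      nlinarith [sq_nonneg x]
    rw [Polynomial.eval_monomial, abs_mul, abs_mul, abs_pow, Real.abs_exp, mul_assoc]
    refine mul_le_mul_of_nonneg_left ?_ (abs_nonneg a)
    calc |x| ^ m * Real.exp (-x ^ 2 / 2)
        ≤ (1 + x ^ (2 * m)) * Real.exp (-x ^ 2 / 2) :=
          mul_le_mul_of_nonneg_right h1 (Real.exp_pos _).le
      _ ≤ 1 + 2 ^ m * m ! := by rw [add_mul, one_mul]; exact add_le_add h3 h2

theorem polyGaussian_contDiff (p : Polynomial ℝ) :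
    ContDiff ℝ ∞ (fun x : ℝ => p.eval x * Real.exp (-x ^ 2 / 2)) := by
  have : ContDiff ℝ ∞ (fun x : ℝ => p.eval x) := by
    simpa [Polynomial.aeval_def, Polynomial.eval₂_eq_eval_map] using p.contDiff_aeval (𝕜 := ℝ) ∞
  fun_prop

theorem polyGaussian_iteratedDeriv (n : ℕ) (p : Polynomial ℝ) :
    ∃ q : Polynomial ℝ, iteratedDeriv n (fun x : ℝ => p.eval x * Real.exp (-x ^ 2 / 2)) =
      fun x : ℝ => q.eval x * Real.exp (-x ^ 2 / 2) := by
  induction n with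
  | zero => exact ⟨p, by simp⟩
  | succ n ih =>
    obtain ⟨q, hq⟩ := ih
    refine ⟨Polynomial.derivative q - Polynomial.X * q, ?_⟩
    rw [iteratedDeriv_succ, hq]
    funext x
    have hg : HasDerivAt (fun x : ℝ => -x ^ 2 / 2) (-x) x := by
      have := ((hasDerivAt_pow 2 x).neg).div_const 2
      exact this.congr_deriv (by norm_num; ring)
    have h := (q.hasDerivAt x).mul hg.exp
    have h' := h.deriv
    simp only [Polynomial.eval_sub, Polynomial.eval_mul, Polynomial.eval_X]
    refine Eq.trans h' ?_
    ring

theorem polyGaussian_decay (p : Polynomial ℝ) (k n : ℕ) :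
    ∃ C : ℝ, ∀ x : ℝ, ‖x‖ ^ k *
      ‖iteratedFDeriv ℝ n (fun x : ℝ => p.eval x * Real.exp (-x ^ 2 / 2)) x‖ ≤ C := by
  obtain ⟨q, hq⟩ := polyGaussian_iteratedDeriv n p
  obtain ⟨C, hC⟩ := polyGaussian_bounded (Polynomial.X ^ k * q)
  refine ⟨C, fun x => ?_⟩
  rw [norm_iteratedFDeriv_eq_norm_iteratedDeriv, hq]
  have h := hC x
  rw [Polynomial.eval_mul, Polynomial.eval_pow, Polynomial.eval_X, mul_assoc, abs_mul,
    abs_pow] at h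
  exact h

/-- The Hermite functions (eigenstates of the quantum harmonic oscillator)
`e_n(x) = (2 ^ n n! √π)^(-1/2) H_n(x) exp (-x² / 2)`, as real-valued Schwartz functions. -/
noncomputable def hermiteFunction (n : ℕ) : 𝓢(ℝ, ℝ) :=
  (1 / √(2 ^ n * n ! * √Real.pi)) •
    { toFun := fun x => (physHermite n).eval x * Real.exp (-x ^ 2 / 2)
      smooth' := polyGaussian_contDiff _
      decay' := polyGaussian_decay _ }

theorem hermiteFunction_apply (n : ℕ) (x : ℝ) :
    hermiteFunction n x = 1 / √(2 ^ n * n ! * √Real.pi) *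
      ((physHermite n).eval x * Real.exp (-x ^ 2 / 2)) := rfl

/-- A real-valued Schwartz function regarded as a complex-valued one. -/
noncomputable def schwartzOfReal (f : 𝓢(ℝ, ℝ)) : 𝓢(ℝ, ℂ) :=
  SchwartzMap.postcompCLM Complex.ofRealCLM f

theorem schwartzOfReal_apply (f : 𝓢(ℝ, ℝ)) (x : ℝ) : schwartzOfReal f x = (f x : ℂ) := rfl

/-- `F` and `G` have `e`-product `⟨F, G⟩_e = s` with respect to the sequence `e` of real-valued
Schwartz functions: the series `∑ conj (F[e n]) * G[e n]` converges (in the sense of partial sums,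
not necessarily absolutely) and its sum is `s`. -/
def HasEProduct (e : ℕ → 𝓢(ℝ, ℝ)) (F G : 𝓢'(ℝ, ℂ)) (s : ℂ) : Prop :=
  Tendsto (fun N : ℕ => ∑ n ∈ Finset.range N,
    (starRingEnd ℂ) (F (schwartzOfReal (e n))) * G (schwartzOfReal (e n))) atTop (𝓝 s)

/-! ### Cosine and sine as tempered distributions -/

theorem cos_hasTemperateGrowth : (fun x : ℝ => (Real.cos x : ℂ)).HasTemperateGrowth := by
  have h : Function.HasTemperateGrowth Real.cos := by
    refine ⟨Real.contDiff_cos, fun n => ⟨0, 1, fun x => ?_⟩⟩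
    rw [norm_iteratedFDeriv_eq_norm_iteratedDeriv]
    simpa using Real.abs_iteratedDeriv_cos_le_one n x
  exact Function.HasTemperateGrowth.comp Function.Complex.hasTemperateGrowth_ofReal h

theorem sin_hasTemperateGrowth : (fun x : ℝ => (Real.sin x : ℂ)).HasTemperateGrowth := by
  have h : Function.HasTemperateGrowth Real.sin := by
    refine ⟨Real.contDiff_sin, fun n => ⟨0, 1, fun x => ?_⟩⟩
    rw [norm_iteratedFDeriv_eq_norm_iteratedDeriv]
    simpa using Real.abs_iteratedDeriv_sin_le_one n x
  exact Function.HasTemperateGrowth.comp Function.Complex.hasTemperateGrowth_ofReal h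

/-- The tempered distribution `φ ↦ ∫ φ(x) cos x dx`. -/
noncomputable def cosDistribution : 𝓢'(ℝ, ℂ) :=
  Function.HasTemperateGrowth.toTemperedDistribution volume cos_hasTemperateGrowth

/-- The tempered distribution `φ ↦ ∫ φ(x) sin x dx`. -/
noncomputable def sinDistribution : 𝓢'(ℝ, ℂ) :=
  Function.HasTemperateGrowth.toTemperedDistribution volume sin_hasTemperateGrowth

/-! Integration by parts gives `∫ H_n(x) exp(-x²/2) exp(ix) dx = i^n H_n(1) √(2π) exp(-1/2)`
(`gaussianFourier_physHermite`); its real and imaginary parts evaluate `cos` and `sin` on the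
Hermite functions. The `sin`-`δ` terms all vanish by parity, and the `cos`-`δ` terms are `√2
exp(-1/2)` times those of the series in part 2, so everything rests on that series.

Write `w_l = centralBinomRatio l`. Odd terms vanish and `H_{2l}(0) = (-1)^l w_l 4^l l!`, so the
series is the limit of `E_N(1)`, where `E_N = ∑_{l<N} H_{2l} / (4^l l!)`. At `0` the sums `E_N(0)`
are those of the binomial series `(1+t)^(-1/2)` at `t = 1`, with limit `1/√2`. Formally `E_∞(x)
exp(-x²/2)` is constant: the derivative of `E_{N+1}(x) exp(-x²/2)` telescopes to a multiple of `u =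
H_{2N+1} exp(-x²/2)`. That remainder is not small pointwise, but its integral over `[0,1]` is
`O(w_N)`, by the oscillator equation and an energy bound (`evenHermiteSum_one_sub_le`). Since `w_N →
0`, `E_N(1) → √(e/2)`. -/

/-! ### Central binomial coefficients -/

/-- The normalized central binomial coefficient `(2n choose n) / 4 ^ n`. -/
noncomputable def centralBinomRatio (n : ℕ) : ℝ := (n.centralBinom : ℝ) / 4 ^ n

theorem centralBinomRatio_nonneg (n : ℕ) : 0 ≤ centralBinomRatio n := by
  unfold centralBinomRatio; positivity

theorem centralBinomRatio_zero : centralBinomRatio 0 = 1 := by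
  simp [centralBinomRatio]

theorem two_mul_succ_mul_centralBinomRatio_succ (n : ℕ) :
    2 * ((n : ℝ) + 1) * centralBinomRatio (n + 1) = (2 * n + 1) * centralBinomRatio n := by
  have h : ((n : ℝ) + 1) * (n + 1).centralBinom = 2 * (2 * n + 1) * n.centralBinom := by
    exact_mod_cast Nat.succ_mul_centralBinom_succ n
  unfold centralBinomRatio
  rw [pow_succ]
  field_simp
  linarith

/-- The ratio of consecutive terms is `(2n+1)/(2n+2)`, and `(2n+1)(2n+3) ≤ (2n+2)²`. -/
theorem centralBinomRatio_sq_le (n : ℕ) : (2 * (n : ℝ) + 1) * centralBinomRatio n ^ 2 ≤ 1 := by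
  induction n with
  | zero => simp [centralBinomRatio_zero]
  | succ n ih =>
    have h := two_mul_succ_mul_centralBinomRatio_succ n
    have hn : (0 : ℝ) < (2 * ((n : ℝ) + 1)) ^ 2 := by positivity
    have h2 : (2 * ((n : ℝ) + 1)) ^ 2 * centralBinomRatio (n + 1) ^ 2 =
        (2 * n + 1) ^ 2 * centralBinomRatio n ^ 2 := by
      rw [← mul_pow, h, mul_pow]
    push_cast
    have h3 : (2 * ((n : ℝ) + 1)) ^ 2 * ((2 * ((n : ℝ) + 1) + 1) * centralBinomRatio (n + 1) ^ 2) ≤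
        (2 * ((n : ℝ) + 1)) ^ 2 * 1 := by
      calc (2 * ((n : ℝ) + 1)) ^ 2 * ((2 * ((n : ℝ) + 1) + 1) * centralBinomRatio (n + 1) ^ 2)
          = (2 * (n : ℝ) + 3) * (2 * n + 1) * ((2 * n + 1) * centralBinomRatio n ^ 2) := by
            linear_combination (2 * ((n : ℝ) + 1) + 1) * h2
        _ ≤ (2 * (n : ℝ) + 3) * (2 * n + 1) * 1 := mul_le_mul_of_nonneg_left ih (by positivity)
        _ ≤ (2 * ((n : ℝ) + 1)) ^ 2 * 1 := by nlinarith
    exact le_of_mul_le_mul_left h3 hn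

theorem tendsto_centralBinomRatio : Tendsto centralBinomRatio atTop (𝓝 0) := by
  have h : Tendsto (fun n : ℕ => √(1 / ((n : ℝ) + 1))) atTop (𝓝 0) := by
    simpa using (tendsto_one_div_add_atTop_nhds_zero_nat (𝕜 := ℝ)).sqrt
  refine squeeze_zero centralBinomRatio_nonneg (fun n => Real.le_sqrt_of_sq_le ?_) h
  rw [le_div_iff₀ (by positivity)]
  have h1 := centralBinomRatio_sq_le n
  nlinarith [mul_nonneg n.cast_nonneg (sq_nonneg (centralBinomRatio n))]

/-- A partial sum of the binomial series of `(1 + t) ^ (-1/2)`. -/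
noncomputable def binomialPartialSum (N : ℕ) (t : ℝ) : ℝ :=
  ∑ l ∈ Finset.range N, (-1) ^ l * centralBinomRatio l * t ^ l

theorem binomialPartialSum_succ (N : ℕ) (t : ℝ) : binomialPartialSum (N + 1) t =
    binomialPartialSum N t + (-1) ^ N * centralBinomRatio N * t ^ N :=
  Finset.sum_range_succ _ _

/-- The equation `(1+t) f' + f/2 = 0` characterizes multiples of `(1+t)^(-1/2)`; truncating the
series leaves one boundary monomial. -/
theorem hasDerivAt_binomialPartialSum (N : ℕ) (t : ℝ) : ∃ f' : ℝ,
    HasDerivAt (binomialPartialSum (N + 1)) f' t ∧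
    (1 + t) * f' + binomialPartialSum (N + 1) t / 2 =
      (-1) ^ N * (N + 1) * centralBinomRatio (N + 1) * t ^ N := by
  induction N with
  | zero =>
    have h1 : binomialPartialSum 1 = fun _ => 1 := by
      funext s; simp [binomialPartialSum, centralBinomRatio_zero]
    refine ⟨0, by rw [zero_add, h1]; exact hasDerivAt_const _ _, ?_⟩
    have := two_mul_succ_mul_centralBinomRatio_succ 0
    rw [centralBinomRatio_zero] at this
    rw [zero_add, h1]
    norm_num at this ⊢
    linarith
  | succ N ih =>
    obtain ⟨f', hf, h⟩ := ih
    have he : binomialPartialSum (N + 1 + 1) = fun t => binomialPartialSum (N + 1) t +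
        (-1) ^ (N + 1) * centralBinomRatio (N + 1) * t ^ (N + 1) :=
      funext fun t => binomialPartialSum_succ _ _
    refine ⟨_, by rw [he]; exact hf.add ((hasDerivAt_pow (N + 1) t).const_mul _), ?_⟩
    have := two_mul_succ_mul_centralBinomRatio_succ (N + 1)
    rw [he]
    push_cast at this ⊢
    linear_combination h - (-1) ^ (N + 1) * t ^ (N + 1) / 2 * this

/-- By the truncated equation, `√(1+t) f` has derivative `± (N+1) w_{N+1} t^N / √(1+t)`, dominated
on `[0,1]` by the derivative of `w_{N+1} t^(N+1)`. This controls the endpoint `t = 1`, where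
convergence is only conditional. -/
theorem abs_sqrt_two_mul_binomialPartialSum_sub_one_le (N : ℕ) :
    |√2 * binomialPartialSum (N + 1) 1 - 1| ≤ centralBinomRatio (N + 1) := by
  -- The signs `ε = 1` and `ε = -1` yield the two halves of the absolute value bound.
  have key : ∀ ε : ℝ, |ε| = 1 → MonotoneOn (fun t => centralBinomRatio (N + 1) * t ^ (N + 1) +
      ε * (√(1 + t) * binomialPartialSum (N + 1) t)) (Set.Icc 0 1) := by
    intro ε hε
    have hd : ∀ t ∈ Set.Icc (0 : ℝ) 1, ∃ d, 0 ≤ d ∧ HasDerivAt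
        (fun t => centralBinomRatio (N + 1) * t ^ (N + 1) +
          ε * (√(1 + t) * binomialPartialSum (N + 1) t)) d t := by
      intro t ht
      obtain ⟨f', hf, h⟩ := hasDerivAt_binomialPartialSum N t
      have h1 : 1 ≤ 1 + t := by linarith [ht.1]
      have hs : 1 ≤ √(1 + t) := Real.one_le_sqrt.mpr h1
      have hs0 : 0 < √(1 + t) := by linarith
      have hss : √(1 + t) ^ 2 = 1 + t := Real.sq_sqrt (by linarith)
      have hr : HasDerivAt (fun t : ℝ => √(1 + t)) (1 / (2 * √(1 + t))) t :=
        ((hasDerivAt_id t).const_add 1).sqrt (by simp only [id]; linarith)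
      refine ⟨_, ?_, ((hasDerivAt_pow (N + 1) t).const_mul _).add
        ((hr.mul hf).const_mul ε)⟩
      have e : 1 / (2 * √(1 + t)) * binomialPartialSum (N + 1) t + √(1 + t) * f' =
          (-1) ^ N * (N + 1) * centralBinomRatio (N + 1) * t ^ N / √(1 + t) := by
        rw [← h]; field_simp; rw [hss]; ring
      simp only [add_tsub_cancel_right]
      rw [e]
      set A := ((N : ℝ) + 1) * centralBinomRatio (N + 1) * t ^ N with hA
      have hA0 : 0 ≤ A := by
        have := centralBinomRatio_nonneg (N + 1)
        have := ht.1
        positivity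
      have hb : |ε * ((-1) ^ N * (N + 1) * centralBinomRatio (N + 1) * t ^ N / √(1 + t))| ≤ A := by
        have : (-1) ^ N * (N + 1) * centralBinomRatio (N + 1) * t ^ N / √(1 + t) =
          (-1) ^ N * (A / √(1 + t)) := by rw [hA]; ring
        rw [this, abs_mul, hε, abs_mul, abs_pow, abs_neg, abs_one, one_pow, one_mul, one_mul,
          abs_of_nonneg (by positivity)]
        exact div_le_self hA0 hs
      have := (abs_le.mp hb).1
      push_cast
      nlinarith
    refine monotoneOn_of_deriv_nonneg (convex_Icc 0 1) ?_ ?_ ?_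
    · intro t ht
      obtain ⟨d, -, h⟩ := hd t ht
      exact h.continuousAt.continuousWithinAt
    · intro t ht
      obtain ⟨d, -, h⟩ := hd t (interior_subset ht)
      exact h.differentiableAt.differentiableWithinAt
    · intro t ht
      obtain ⟨d, h0, h⟩ := hd t (interior_subset ht)
      rwa [h.deriv]
  have h0 : binomialPartialSum (N + 1) 0 = 1 := by
    simp [binomialPartialSum, Finset.sum_range_succ', centralBinomRatio_zero]
  have hmono := fun ε hε => key ε hε (Set.left_mem_Icc.mpr zero_le_one)
    (Set.right_mem_Icc.mpr zero_le_one) zero_le_one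
  have hp := hmono 1 (by simp)
  have hm := hmono (-1) (by simp)
  have h2 : (1 : ℝ) + 1 = 2 := by norm_num
  simp only [h0, h2, one_pow, add_zero, Real.sqrt_one, ne_eq, Nat.succ_ne_zero,
    not_false_eq_true, zero_pow, mul_zero, mul_one, zero_add] at hp hm
  rw [abs_le]
  constructor <;> linarith

theorem tendsto_binomialPartialSum_one :
    Tendsto (fun N => binomialPartialSum (N + 1) 1) atTop (𝓝 (1 / √2)) := by
  have h : Tendsto (fun N => √2 * binomialPartialSum (N + 1) 1 - 1) atTop (𝓝 0) :=
    squeeze_zero_norm abs_sqrt_two_mul_binomialPartialSum_sub_one_le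
      ((tendsto_add_atTop_iff_nat 1).mpr tendsto_centralBinomRatio)
  have h' := (h.add_const 1).div_const √2
  have h2 : √2 ≠ 0 := by positivity
  refine (h'.congr fun N => ?_).trans (by rw [zero_add])
  field_simp
  ring

/-! ### Hermite polynomials -/

theorem physHermite_succ (n : ℕ) : physHermite (n + 1) =
    2 * Polynomial.X * physHermite n - Polynomial.derivative (physHermite n) := rfl

theorem derivative_physHermite_succ (n : ℕ) : Polynomial.derivative (physHermite (n + 1)) =
    2 * ((n : Polynomial ℝ) + 1) * physHermite n := by
  induction n with
  | zero => simp [physHermite]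
  | succ n ih =>
    have h2 : Polynomial.derivative (2 : Polynomial ℝ) = 0 := Polynomial.derivative_ofNat 2
    have hn : Polynomial.derivative ((n : Polynomial ℝ) + 1) = 0 := by simp
    rw [physHermite_succ (n + 1), Polynomial.derivative_sub, Polynomial.derivative_mul,
      Polynomial.derivative_mul, h2, Polynomial.derivative_X]
    rw [ih, Polynomial.derivative_mul, Polynomial.derivative_mul, h2, hn, physHermite_succ n]
    push_cast
    ring

theorem physHermite_succ_succ (n : ℕ) : physHermite (n + 2) =
    2 * Polynomial.X * physHermite (n + 1) - 2 * ((n : Polynomial ℝ) + 1) * physHermite n := by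
  rw [physHermite_succ (n + 1), derivative_physHermite_succ]

theorem eval_derivative_physHermite_succ (n : ℕ) (x : ℝ) :
    (Polynomial.derivative (physHermite (n + 1))).eval x =
      2 * ((n : ℝ) + 1) * (physHermite n).eval x := by
  rw [derivative_physHermite_succ]; simp

theorem eval_physHermite_succ_succ (n : ℕ) (x : ℝ) : (physHermite (n + 2)).eval x =
    2 * x * (physHermite (n + 1)).eval x - 2 * ((n : ℝ) + 1) * (physHermite n).eval x := by
  rw [physHermite_succ_succ]; simp

theorem eval_physHermite_odd_zero (l : ℕ) : (physHermite (2 * l + 1)).eval 0 = 0 := by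
  induction l with
  | zero => simp [physHermite]
  | succ l ih =>
    rw [show 2 * (l + 1) + 1 = 2 * l + 1 + 2 by ring, eval_physHermite_succ_succ, ih]
    simp

theorem eval_physHermite_even_zero (l : ℕ) :
    (physHermite (2 * l)).eval 0 = (-1) ^ l * centralBinomRatio l * (4 ^ l * l !) := by
  induction l with
  | zero => simp [physHermite, centralBinomRatio_zero]
  | succ l ih =>
    have h := two_mul_succ_mul_centralBinomRatio_succ l
    rw [show 2 * (l + 1) = 2 * l + 2 by ring, eval_physHermite_succ_succ, ih, Nat.factorial_succ]
    push_cast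
    linear_combination 2 * (-1) ^ l * 4 ^ l * (l ! : ℝ) * h

theorem factorial_two_mul_eq (l : ℕ) :
    ((2 * l)! : ℝ) = centralBinomRatio l * 4 ^ l * (l ! : ℝ) ^ 2 := by
  have h : (l.centralBinom : ℝ) * l ! * l ! = (2 * l)! := by
    have := Nat.choose_mul_factorial_mul_factorial (show l ≤ 2 * l by omega)
    rw [show 2 * l - l = l by omega] at this
    exact_mod_cast this
  rw [← h, centralBinomRatio]
  field_simp

/-! ### The Hermite oscillator -/

theorem hasDerivAt_exp_neg_sq_div_two (x : ℝ) :
    HasDerivAt (fun x : ℝ => Real.exp (-x ^ 2 / 2)) (-x * Real.exp (-x ^ 2 / 2)) x := by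
  have h : HasDerivAt (fun x : ℝ => -x ^ 2 / 2) (-x) x :=
    (((hasDerivAt_pow 2 x).neg).div_const 2).congr_deriv (by norm_num; ring)
  exact h.exp.congr_deriv (by ring)

theorem hasDerivAt_eval_mul_gaussian (p : Polynomial ℝ) (x : ℝ) :
    HasDerivAt (fun x : ℝ => p.eval x * Real.exp (-x ^ 2 / 2))
      ((Polynomial.derivative p - Polynomial.X * p).eval x * Real.exp (-x ^ 2 / 2)) x := by
  refine ((p.hasDerivAt x).mul (hasDerivAt_exp_neg_sq_div_two x)).congr_deriv ?_
  simp only [Polynomial.eval_sub, Polynomial.eval_mul, Polynomial.eval_X]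
  ring

/-- The derivative of `H_n(x) exp (-x² / 2)`. -/
noncomputable def hermiteSlope (n : ℕ) (x : ℝ) : ℝ :=
  (Polynomial.derivative (physHermite n) - Polynomial.X * physHermite n).eval x *
    Real.exp (-x ^ 2 / 2)

/-- The oscillator equation `u'' = (x² - (2n+1)) u`, from differentiating the recursion and using
`H_{n+1}' = 2(n+1) H_n`. -/
theorem hasDerivAt_hermiteSlope (n : ℕ) (x : ℝ) : HasDerivAt (hermiteSlope n)
    ((x ^ 2 - (2 * n + 1)) * ((physHermite n).eval x * Real.exp (-x ^ 2 / 2))) x := by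
  refine (hasDerivAt_eval_mul_gaussian _ x).congr_deriv ?_
  rw [← mul_assoc]
  congr 1
  have h : Polynomial.derivative (physHermite n) =
      2 * Polynomial.X * physHermite n - physHermite (n + 1) := by
    rw [physHermite_succ]; ring
  have h' := congrArg (fun p => (Polynomial.derivative p).eval x) h
  have h2 : Polynomial.derivative (2 : Polynomial ℝ) = 0 := Polynomial.derivative_ofNat 2
  simp only [Polynomial.derivative_sub, Polynomial.derivative_mul, h2,
    Polynomial.derivative_X, Polynomial.eval_sub, Polynomial.eval_mul, Polynomial.eval_add,
    Polynomial.eval_X, Polynomial.eval_ofNat, Polynomial.eval_zero, Polynomial.eval_one,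
    eval_derivative_physHermite_succ] at h' ⊢
  linear_combination h'

/-- The oscillator equation cancels the `u u'` terms in the derivative of this energy, leaving `-2x
u²`. -/
theorem hermite_energy_antitone (n : ℕ) : AntitoneOn (fun x => hermiteSlope n x ^ 2 +
    (2 * n + 1 - x ^ 2) * ((physHermite n).eval x * Real.exp (-x ^ 2 / 2)) ^ 2) (Set.Ici 0) := by
  have hd : ∀ x : ℝ, HasDerivAt (fun x => hermiteSlope n x ^ 2 +
      (2 * n + 1 - x ^ 2) * ((physHermite n).eval x * Real.exp (-x ^ 2 / 2)) ^ 2)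
      (-(2 * x * ((physHermite n).eval x * Real.exp (-x ^ 2 / 2)) ^ 2)) x := by
    intro x
    have h1 := (hasDerivAt_hermiteSlope n x).pow 2
    have h2 := ((hasDerivAt_pow 2 x).const_sub (2 * (n : ℝ) + 1)).mul
      ((hasDerivAt_eval_mul_gaussian (physHermite n) x).pow 2)
    refine (h1.add h2).congr_deriv ?_
    simp only [hermiteSlope, Nat.cast_ofNat, Pi.pow_apply]
    ring
  refine antitoneOn_of_deriv_nonpos (convex_Ici 0)
    (fun x _ => (hd x).continuousAt.continuousWithinAt)
    (fun x _ => (hd x).differentiableAt.differentiableWithinAt) (fun x hx => ?_)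
  rw [interior_Ici, Set.mem_Ioi] at hx
  rw [(hd x).deriv, neg_nonpos]
  positivity

theorem hermite_odd_bound (N : ℕ) {x : ℝ} (h0 : 0 ≤ x) (h1 : x ≤ 1) :
    |(physHermite (2 * N + 1)).eval x * Real.exp (-x ^ 2 / 2)| ≤ |hermiteSlope (2 * N + 1) 0| ∧
      |hermiteSlope (2 * N + 1) x| ≤ |hermiteSlope (2 * N + 1) 0| := by
  have h := hermite_energy_antitone (2 * N + 1) Set.self_mem_Ici h0 h0
  simp only [eval_physHermite_odd_zero] at h
  set u := (physHermite (2 * N + 1)).eval x * Real.exp (-x ^ 2 / 2)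
  -- On `[0,1]` the energy thus dominates `u'² + u²`, while at `0` it equals `u'(0)²` because `u` is
  -- odd.
  have hc : (1 : ℝ) ≤ 2 * ((2 * N + 1 : ℕ) : ℝ) + 1 - x ^ 2 := by
    push_cast
    have : (0 : ℝ) ≤ N := N.cast_nonneg
    nlinarith
  have hu := mul_le_mul_of_nonneg_right hc (sq_nonneg u)
  have hv := sq_nonneg (hermiteSlope (2 * N + 1) x)
  have hu0 := sq_nonneg u
  constructor <;> refine sq_le_sq.mp ?_ <;> nlinarith

theorem hermiteSlope_odd_zero (N : ℕ) : |hermiteSlope (2 * N + 1) 0| =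
    2 * (2 * N + 1) * centralBinomRatio N * (4 ^ N * N !) := by
  have hw := centralBinomRatio_nonneg N
  have : hermiteSlope (2 * N + 1) 0 =
      (-1) ^ N * (2 * (2 * N + 1) * centralBinomRatio N * (4 ^ N * N !)) := by
    rw [hermiteSlope, Polynomial.eval_sub, eval_derivative_physHermite_succ,
      eval_physHermite_even_zero]
    simp
    ring
  rw [this, abs_mul, abs_pow, abs_neg, abs_one, one_pow, one_mul, abs_of_nonneg (by positivity)]

/-! ### The even Hermite series -/

/-- The partial sums of `∑ H_{2l} / (4 ^ l l!)`. -/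
noncomputable def evenHermiteSum (N : ℕ) : Polynomial ℝ :=
  ∑ l ∈ Finset.range N, Polynomial.C (1 / (4 ^ l * l ! : ℝ)) * physHermite (2 * l)

theorem evenHermiteSum_succ (N : ℕ) : evenHermiteSum (N + 1) =
    evenHermiteSum N + Polynomial.C (1 / (4 ^ N * N ! : ℝ)) * physHermite (2 * N) :=
  Finset.sum_range_succ _ _

theorem eval_evenHermiteSum_zero (N : ℕ) :
    (evenHermiteSum N).eval 0 = binomialPartialSum N 1 := by
  rw [evenHermiteSum, binomialPartialSum, Polynomial.eval_finsetSum]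
  refine Finset.sum_congr rfl fun l _ => ?_
  rw [Polynomial.eval_mul, Polynomial.eval_C, eval_physHermite_even_zero]
  have : (l ! : ℝ) ≠ 0 := by positivity
  rw [one_pow]
  field_simp

/-- Up to the Gaussian factor this is the derivative of `E_{N+1} exp(-x²/2)`. Since `x H_{2l} =
H_{2l+1}/2 + 2l H_{2l-1}`, the sum telescopes. -/
theorem eval_derivative_evenHermiteSum (N : ℕ) (x : ℝ) :
    (Polynomial.derivative (evenHermiteSum (N + 1)) - Polynomial.X * evenHermiteSum (N + 1)).eval x
      = -(1 / (2 * (4 ^ N * N !))) * (physHermite (2 * N + 1)).eval x := by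
  induction N with
  | zero => simp [evenHermiteSum, physHermite]
  | succ N ih =>
    rw [evenHermiteSum_succ (N + 1)]
    have h1 := eval_derivative_physHermite_succ (2 * N + 1) x
    have h2 := eval_physHermite_succ_succ (2 * N + 1) x
    rw [show 2 * N + 1 + 2 = 2 * (N + 1) + 1 by ring, show 2 * N + 1 + 1 = 2 * (N + 1) by ring]
      at h2
    rw [show 2 * N + 1 + 1 = 2 * (N + 1) by ring] at h1
    simp only [Polynomial.eval_sub, Polynomial.eval_mul, Polynomial.eval_X, Polynomial.eval_add,
      Polynomial.derivative_add, Polynomial.derivative_mul, Polynomial.derivative_C,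
      Polynomial.eval_C, zero_mul, zero_add] at ih ⊢
    rw [h1, h2, Nat.factorial_succ]
    have : (N ! : ℝ) ≠ 0 := by positivity
    have hN : (N : ℝ) + 1 ≠ 0 := by positivity
    push_cast
    rw [pow_succ]
    have e : ∀ a b c d y : ℝ, (a + b) - (x * (c + d)) = y ↔ a - x * c = y - b + x * d := by
      intros; constructor <;> intro h <;> linarith
    rw [e, ih]
    field_simp
    ring

/-- The derivative is `-b u`. Substituting `(2n+1) u = x² u - u''` with `n = 2N+1` gains a factor
`2n+1`: the `u''` part integrates to `c u'`, and `c x² u` remains. The two boundary values of `c u'`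
and the remaining integral each cost at most `c |u'(0)| ≤ w_N`, whence the `3`. -/
theorem evenHermiteSum_one_sub_le (N : ℕ) :
    |(evenHermiteSum (N + 1)).eval 1 * Real.exp (-1 / 2) - (evenHermiteSum (N + 1)).eval 0| ≤
      3 * centralBinomRatio N := by
  set b : ℝ := 1 / (2 * (4 ^ N * N !)) with hb
  set c : ℝ := b / (2 * ((2 * N + 1 : ℕ) : ℝ) + 1) with hc
  set M : ℝ := |hermiteSlope (2 * N + 1) 0| with hM
  have hb0 : 0 < b := by positivity
  have hc0 : 0 < c := by positivity
  have hcb : c * (2 * ((2 * N + 1 : ℕ) : ℝ) + 1) = b := by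
    rw [hc]; field_simp
  have hd : ∀ x : ℝ, HasDerivAt (fun x => (evenHermiteSum (N + 1)).eval x * Real.exp (-x ^ 2 / 2)
      - c * hermiteSlope (2 * N + 1) x)
      (-(c * x ^ 2 * ((physHermite (2 * N + 1)).eval x * Real.exp (-x ^ 2 / 2)))) x := by
    intro x
    refine ((hasDerivAt_eval_mul_gaussian (evenHermiteSum (N + 1)) x).sub
      ((hasDerivAt_hermiteSlope (2 * N + 1) x).const_mul c)).congr_deriv ?_
    rw [eval_derivative_evenHermiteSum, ← hb]
    linear_combination ((physHermite (2 * N + 1)).eval x * Real.exp (-x ^ 2 / 2)) * hcb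
  have hbd := (convex_Icc (0 : ℝ) 1).norm_image_sub_le_of_norm_hasDerivWithin_le (C := c * M)
    (fun x _ => (hd x).hasDerivWithinAt) (fun x hx => ?_)
    (Set.left_mem_Icc.mpr zero_le_one) (Set.right_mem_Icc.mpr zero_le_one)
  · have h1 := (hermite_odd_bound N zero_le_one le_rfl).2
    have hcM : 3 * (c * M) ≤ 3 * centralBinomRatio N := by
      have hw := centralBinomRatio_nonneg N
      have : (N ! : ℝ) ≠ 0 := by positivity
      have e : c * M = (2 * N + 1) / (2 * (2 * N + 1) + 1) * centralBinomRatio N := by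
        rw [hM, hermiteSlope_odd_zero, hc, hb]
        push_cast
        field_simp
      rw [e]
      refine mul_le_mul_of_nonneg_left (mul_le_of_le_one_left hw ?_) (by norm_num)
      rw [div_le_one (by positivity)]
      have : (0 : ℝ) ≤ N := N.cast_nonneg
      linarith
    have h1' := mul_le_mul_of_nonneg_left h1 hc0.le
    have h2 := abs_le.mp (show |c * hermiteSlope (2 * N + 1) 1| ≤ c * M by
      rwa [abs_mul, abs_of_pos hc0])
    have h3 := abs_le.mp (show |c * hermiteSlope (2 * N + 1) 0| ≤ c * M by
      rw [abs_mul, abs_of_pos hc0])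
    simp only [Real.norm_eq_abs, sub_zero, abs_one, mul_one, one_pow, ne_eq, OfNat.ofNat_ne_zero,
      not_false_eq_true, zero_pow, neg_zero, zero_div, Real.exp_zero] at hbd
    have h4 := abs_le.mp hbd
    rw [abs_le]
    constructor <;> linarith
  · rw [Real.norm_eq_abs, abs_neg, abs_mul, abs_of_nonneg (by positivity)]
    refine mul_le_mul (mul_le_of_le_one_right hc0.le ?_) (hermite_odd_bound N hx.1 hx.2).1
      (abs_nonneg _) hc0.le
    nlinarith [hx.1, hx.2]

theorem tendsto_evenHermiteSum_one :
    Tendsto (fun N => (evenHermiteSum N).eval 1) atTop (𝓝 √(Real.exp 1 / 2)) := by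
  rw [← tendsto_add_atTop_iff_nat 1]
  have h : Tendsto (fun N => (evenHermiteSum (N + 1)).eval 1 * Real.exp (-1 / 2) -
      (evenHermiteSum (N + 1)).eval 0) atTop (𝓝 0) :=
    squeeze_zero_norm evenHermiteSum_one_sub_le
      (by simpa using tendsto_centralBinomRatio.const_mul 3)
  have h' := ((h.add (tendsto_binomialPartialSum_one.congr
    fun N => (eval_evenHermiteSum_zero _).symm)).mul_const (Real.exp (1 / 2)))
  have e : √(Real.exp 1 / 2) = (0 + 1 / √2) * Real.exp (1 / 2) := by
    rw [Real.sqrt_div (Real.exp_pos 1).le, Real.exp_half]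
    ring
  rw [e]
  refine h'.congr fun N => ?_
  rw [sub_add_cancel, mul_assoc, ← Real.exp_add]
  norm_num

/-! ### Reduction of the full Hermite series to its even terms -/

/-- Partial sums of a series whose odd terms vanish converge if those of the even terms do. -/
theorem tendsto_sum_range_of_odd_eq_zero {E : Type*} [AddCommMonoid E] [TopologicalSpace E]
    {f : ℕ → E} {s : E} (hodd : ∀ l, f (2 * l + 1) = 0)
    (h : Tendsto (fun N => ∑ l ∈ Finset.range N, f (2 * l)) atTop (𝓝 s)) :
    Tendsto (fun N => ∑ l ∈ Finset.range N, f l) atTop (𝓝 s) := by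
  have e : ∀ N, ∑ l ∈ Finset.range (2 * N), f l = ∑ l ∈ Finset.range N, f (2 * l) := by
    intro N
    induction N with
    | zero => simp
    | succ N ih =>
      rw [show 2 * (N + 1) = 2 * N + 1 + 1 by ring, Finset.sum_range_succ, Finset.sum_range_succ,
        hodd, ih, Finset.sum_range_succ, add_zero]
  -- `(N + 1) / 2`, rounded down, counts the even indices below `N`.
  have hdiv : Tendsto (fun N : ℕ => (N + 1) / 2) atTop atTop :=
    tendsto_atTop_atTop.mpr fun b => ⟨2 * b, fun a ha => by omega⟩
  refine (h.comp hdiv).congr fun N => ?_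
  rw [Function.comp_apply, ← e]
  obtain ⟨k, rfl | rfl⟩ := N.even_or_odd'
  · rw [show (2 * k + 1) / 2 = k by omega]
  · rw [show (2 * k + 1 + 1) / 2 = k + 1 by omega, show 2 * (k + 1) = 2 * k + 1 + 1 by ring,
      Finset.sum_range_succ _ (2 * k + 1), hodd, add_zero]

theorem hermite_series_term_even (l : ℕ) :
    (-Complex.I) ^ (2 * l) / ((2 : ℂ) ^ (2 * l) * ((2 * l)! : ℂ)) *
      (((physHermite (2 * l)).eval 1 * (physHermite (2 * l)).eval 0 : ℝ) : ℂ) =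
    ((1 / (4 ^ l * l !) * (physHermite (2 * l)).eval 1 : ℝ) : ℂ) := by
  have h1 : (-Complex.I) ^ (2 * l) = (((-1) ^ l : ℝ) : ℂ) := by
    rw [pow_mul, neg_sq, Complex.I_sq]; push_cast; rfl
  have h2 : (2 : ℂ) ^ (2 * l) * ((2 * l)! : ℂ) = ((4 ^ l * ((2 * l)! : ℝ) : ℝ) : ℂ) := by
    rw [pow_mul]; push_cast; norm_num
  have h3 : (0 : ℝ) < (2 * l)! := by positivity
  rw [h1, h2, ← Complex.ofReal_div, ← Complex.ofReal_mul, eval_physHermite_even_zero]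
  congr 1
  rw [factorial_two_mul_eq] at h3 ⊢
  have hw : centralBinomRatio l ≠ 0 := by
    intro h; simp [h] at h3
  have hs : ((-1 : ℝ) ^ l) ^ 2 = 1 := by rw [← pow_mul, mul_comm, pow_mul]; simp
  field_simp
  rw [hs, one_mul]

theorem tendsto_hermite_series : Tendsto (fun N : ℕ => ∑ l ∈ Finset.range N,
    (-Complex.I) ^ l / ((2 : ℂ) ^ l * (l ! : ℂ)) *
      (((physHermite l).eval 1 * (physHermite l).eval 0 : ℝ) : ℂ))
    atTop (𝓝 ((√(Real.exp 1 / 2) : ℝ) : ℂ)) := by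
  refine tendsto_sum_range_of_odd_eq_zero (fun l => by simp [eval_physHermite_odd_zero]) ?_
  refine ((Complex.continuous_ofReal.tendsto _).comp tendsto_evenHermiteSum_one).congr fun N => ?_
  simp only [Function.comp_apply, hermite_series_term_even, evenHermiteSum,
    Polynomial.eval_finsetSum, Complex.ofReal_sum, Polynomial.eval_mul, Polynomial.eval_C]

/-! ### Fourier integrals of polynomials times the Gaussian -/

/-- A polynomial times `exp (-x ^ 2 / 2)`, as a Schwartz function. -/
noncomputable def polyGaussian (p : Polynomial ℝ) : 𝓢(ℝ, ℝ) where
  toFun := fun x => p.eval x * Real.exp (-x ^ 2 / 2)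
  smooth' := polyGaussian_contDiff _
  decay' := polyGaussian_decay _

theorem integrable_polyGaussian_mul_exp (p : Polynomial ℝ) : Integrable (fun x : ℝ =>
    ((p.eval x * Real.exp (-x ^ 2 / 2) : ℝ) : ℂ) * Complex.exp (x * Complex.I)) := by
  have h : Integrable (fun x : ℝ => p.eval x * Real.exp (-x ^ 2 / 2)) :=
    (polyGaussian p).integrable
  refine h.ofReal.mul_bdd (c := 1) (by fun_prop) (ae_of_all _ fun x => ?_)
  rw [Complex.norm_exp_ofReal_mul_I]

/-- The integral of `p(x) exp (-x² / 2) exp (i x)`. -/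
noncomputable def gaussianFourier (p : Polynomial ℝ) : ℂ :=
  ∫ x : ℝ, ((p.eval x * Real.exp (-x ^ 2 / 2) : ℝ) : ℂ) * Complex.exp (x * Complex.I)

theorem gaussianFourier_sub (p q : Polynomial ℝ) :
    gaussianFourier (p - q) = gaussianFourier p - gaussianFourier q := by
  unfold gaussianFourier
  rw [← integral_sub (integrable_polyGaussian_mul_exp p) (integrable_polyGaussian_mul_exp q)]
  refine integral_congr_ae (ae_of_all _ fun x => ?_)
  simp only [Polynomial.eval_sub]
  push_cast
  ring

theorem gaussianFourier_C_mul (a : ℝ) (p : Polynomial ℝ) :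
    gaussianFourier (Polynomial.C a * p) = a * gaussianFourier p := by
  unfold gaussianFourier
  rw [← integral_const_mul]
  refine integral_congr_ae (ae_of_all _ fun x => ?_)
  simp only [Polynomial.eval_mul, Polynomial.eval_C]
  push_cast
  ring

/-- The derivative of `p(x) exp(-x²/2) exp(ix)` integrates to zero over the line. -/
theorem gaussianFourier_X_mul (p : Polynomial ℝ) : gaussianFourier (Polynomial.X * p) =
    gaussianFourier (Polynomial.derivative p) + Complex.I * gaussianFourier p := by
  have hd : ∀ x : ℝ, HasDerivAt (fun x : ℝ =>
      ((p.eval x * Real.exp (-x ^ 2 / 2) : ℝ) : ℂ) * Complex.exp (x * Complex.I))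
      ((((Polynomial.derivative p - Polynomial.X * p).eval x * Real.exp (-x ^ 2 / 2) : ℝ) : ℂ) *
        Complex.exp (x * Complex.I) + Complex.I *
        (((p.eval x * Real.exp (-x ^ 2 / 2) : ℝ) : ℂ) * Complex.exp (x * Complex.I))) x := by
    intro x
    have he : HasDerivAt (fun x : ℝ => Complex.exp (x * Complex.I))
        (Complex.exp (x * Complex.I) * (1 * Complex.I)) x :=
      (((hasDerivAt_id x).ofReal_comp).mul_const Complex.I).cexp
    refine ((hasDerivAt_eval_mul_gaussian p x).ofReal_comp.mul he).congr_deriv ?_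
    ring
  have h1 := integrable_polyGaussian_mul_exp (Polynomial.derivative p - Polynomial.X * p)
  have h2 := (integrable_polyGaussian_mul_exp p).const_mul Complex.I
  have h := integral_eq_zero_of_hasDerivAt_of_integrable hd (h1.add h2)
    (integrable_polyGaussian_mul_exp p)
  rw [integral_add h1 h2, integral_const_mul] at h
  change gaussianFourier _ + Complex.I * gaussianFourier p = 0 at h
  rw [gaussianFourier_sub] at h
  linear_combination -h

theorem gaussianFourier_one :
    gaussianFourier 1 = ((√(2 * Real.pi) * Real.exp (-1 / 2) : ℝ) : ℂ) := by
  have h := fourierIntegral_gaussian (b := 1 / 2) (by norm_num) 1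
  have e1 : (Real.pi / (1 / 2) : ℂ) ^ (1 / 2 : ℂ) = ((√(2 * Real.pi) : ℝ) : ℂ) := by
    rw [Real.sqrt_eq_rpow, Complex.ofReal_cpow (by positivity)]
    push_cast
    congr 1
    ring
  rw [e1] at h
  push_cast
  rw [show (-1 / 2 : ℂ) = -1 ^ 2 / (4 * (1 / 2)) by norm_num, ← h]
  refine integral_congr_ae (ae_of_all _ fun x => ?_)
  simp only [Polynomial.eval_one]
  push_cast
  rw [one_mul, mul_comm]
  congr 2 <;> ring

/-- Both sides satisfy `g_{n+2} = 2i g_{n+1} + 2(n+1) g_n`; on the right, `i² = -1` turns the minus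
sign of the three-term recurrence at `1` into a plus. -/
theorem gaussianFourier_physHermite (n : ℕ) : gaussianFourier (physHermite n) =
    Complex.I ^ n * ((physHermite n).eval 1 : ℝ) * gaussianFourier 1 := by
  have hrec : ∀ n, gaussianFourier (physHermite (n + 1)) =
      2 * Complex.I * gaussianFourier (physHermite n) +
        gaussianFourier (Polynomial.derivative (physHermite n)) := by
    intro n
    have : physHermite (n + 1) = Polynomial.C 2 * (Polynomial.X * physHermite n) -
        Polynomial.derivative (physHermite n) := by
      rw [physHermite_succ, ← mul_assoc]; rfl
    rw [this, gaussianFourier_sub, gaussianFourier_C_mul, gaussianFourier_X_mul]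
    push_cast
    ring
  induction n using Nat.twoStepInduction with
  | zero => simp [physHermite]
  | one =>
    have h0 : gaussianFourier 0 = 0 := by simp [gaussianFourier]
    have h1 : (physHermite 1).eval 1 = 2 := by simp [physHermite]
    have := hrec 0
    rw [show physHermite 0 = 1 from rfl, Polynomial.derivative_one, h0, zero_add] at this
    rw [this, h1]
    push_cast
    ring
  | more n h0 h1 =>
    have hd : Polynomial.derivative (physHermite (n + 1)) =
        Polynomial.C (2 * ((n : ℝ) + 1)) * physHermite n := by
      rw [derivative_physHermite_succ, map_mul, map_add, map_natCast, map_one]; rfl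
    rw [hrec (n + 1), hd, gaussianFourier_C_mul, h0, h1, eval_physHermite_succ_succ]
    push_cast
    linear_combination (2 * ((n : ℂ) + 1) * Complex.I ^ n * ((physHermite n).eval 1 : ℝ) *
      gaussianFourier 1) * Complex.I_sq

theorem hermiteFunction_apply_zero (n : ℕ) : hermiteFunction n 0 =
    1 / √(2 ^ n * n ! * √Real.pi) * (physHermite n).eval 0 := by
  rw [hermiteFunction_apply]; simp

theorem integral_hermiteFunction_mul_exp (n : ℕ) :
    ∫ x : ℝ, ((hermiteFunction n x : ℝ) : ℂ) * Complex.exp (x * Complex.I) =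
      Complex.I ^ n * ((1 / √(2 ^ n * n ! * √Real.pi) * (physHermite n).eval 1 *
        (√(2 * Real.pi) * Real.exp (-1 / 2)) : ℝ) : ℂ) := by
  have h := gaussianFourier_physHermite n
  rw [gaussianFourier_one] at h
  calc ∫ x : ℝ, ((hermiteFunction n x : ℝ) : ℂ) * Complex.exp (x * Complex.I)
      = ((1 / √(2 ^ n * n ! * √Real.pi) : ℝ) : ℂ) * gaussianFourier (physHermite n) := by
        unfold gaussianFourier
        rw [← integral_const_mul]
        refine integral_congr_ae (ae_of_all _ fun x => ?_)
        simp only [hermiteFunction_apply]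
        push_cast
        ring
    _ = _ := by rw [h]; push_cast; ring

theorem integrable_hermiteFunction_mul_exp (n : ℕ) : Integrable (fun x : ℝ =>
    ((hermiteFunction n x : ℝ) : ℂ) * Complex.exp (x * Complex.I)) := by
  refine (hermiteFunction n).integrable.ofReal.mul_bdd (c := 1) (by fun_prop)
    (ae_of_all _ fun x => ?_)
  rw [Complex.norm_exp_ofReal_mul_I]

theorem cosDistribution_hermiteFunction (n : ℕ) :
    cosDistribution (schwartzOfReal (hermiteFunction n)) =
      (((Complex.I ^ n).re * (1 / √(2 ^ n * n ! * √Real.pi) * (physHermite n).eval 1 *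
        (√(2 * Real.pi) * Real.exp (-1 / 2))) : ℝ) : ℂ) := by
  have h := integral_re (𝕜 := ℂ) (integrable_hermiteFunction_mul_exp n)
  rw [integral_hermiteFunction_mul_exp] at h
  change ∫ x : ℝ, schwartzOfReal (hermiteFunction n) x • (Real.cos x : ℂ) = _
  simp only [schwartzOfReal_apply, smul_eq_mul, ← Complex.ofReal_mul, integral_complex_ofReal]
  congr 1
  generalize 1 / √(2 ^ n * n ! * √Real.pi) * (physHermite n).eval 1 *
    (√(2 * Real.pi) * Real.exp (-1 / 2)) = c at h ⊢
  simpa [Complex.exp_ofReal_mul_I_re, Complex.re_mul_ofReal] using h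

theorem sinDistribution_hermiteFunction (n : ℕ) :
    sinDistribution (schwartzOfReal (hermiteFunction n)) =
      (((Complex.I ^ n).im * (1 / √(2 ^ n * n ! * √Real.pi) * (physHermite n).eval 1 *
        (√(2 * Real.pi) * Real.exp (-1 / 2))) : ℝ) : ℂ) := by
  have h := integral_im (𝕜 := ℂ) (integrable_hermiteFunction_mul_exp n)
  rw [integral_hermiteFunction_mul_exp] at h
  change ∫ x : ℝ, schwartzOfReal (hermiteFunction n) x • (Real.sin x : ℂ) = _
  simp only [schwartzOfReal_apply, smul_eq_mul, ← Complex.ofReal_mul, integral_complex_ofReal]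
  congr 1
  generalize 1 / √(2 ^ n * n ! * √Real.pi) * (physHermite n).eval 1 *
    (√(2 * Real.pi) * Real.exp (-1 / 2)) = c at h ⊢
  simpa [Complex.exp_ofReal_mul_I_im, Complex.im_mul_ofReal] using h

/-! ### Normalization constants and the terms of the two `e`-products -/

theorem I_pow_two_mul (l : ℕ) : Complex.I ^ (2 * l) = (((-1) ^ l : ℝ) : ℂ) := by
  rw [pow_mul, Complex.I_sq]; push_cast; rfl

theorem I_pow_two_mul_succ_re (l : ℕ) : (Complex.I ^ (2 * l + 1)).re = 0 := by
  rw [pow_succ, I_pow_two_mul, Complex.re_ofReal_mul]; simp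

theorem one_div_sqrt_mul_sqrt_two_pi (l : ℕ) :
    1 / √(2 ^ (2 * l) * (2 * l)! * √Real.pi) * (√(2 * Real.pi) * Real.exp (-1 / 2)) =
      √(√Real.pi / ((2 : ℝ) ^ (2 * (l : ℤ) - 1) * (2 * l)! * Real.exp 1)) := by
  have hp := Real.pi_pos
  have hs : √Real.pi ^ 2 = Real.pi := Real.sq_sqrt hp.le
  have he : Real.exp (-1 / 2) ^ 2 = 1 / Real.exp 1 := by
    rw [← Real.exp_nat_mul, one_div, ← Real.exp_neg]; norm_num
  have hz : (2 : ℝ) ^ (2 * (l : ℤ) - 1) = 2 ^ (2 * l) / 2 := by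
    rw [zpow_sub₀ two_ne_zero, zpow_one]
    norm_cast
  symm
  rw [Real.sqrt_eq_iff_eq_sq (by positivity) (by positivity), mul_pow, mul_pow, div_pow,
    Real.sq_sqrt (by positivity), Real.sq_sqrt (by positivity), he, hz]
  field_simp
  rw [hs]

/-- For even `n`, `Re(i^n) = (-i)^n` and the two normalizing factors combine with `√(2π)`, leaving
`√2 / (2^n n!)`; for odd `n`, `H_n(0) = 0`. -/
theorem cos_delta_term (n : ℕ) :
    (starRingEnd ℂ) (cosDistribution (schwartzOfReal (hermiteFunction n))) *
        TemperedDistribution.delta 0 (schwartzOfReal (hermiteFunction n)) =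
      ((√2 * Real.exp (-1 / 2) : ℝ) : ℂ) *
      ((-Complex.I) ^ n / ((2 : ℂ) ^ n * (n ! : ℂ)) *
        (((physHermite n).eval 1 * (physHermite n).eval 0 : ℝ) : ℂ)) := by
  rw [cosDistribution_hermiteFunction, TemperedDistribution.delta_apply, schwartzOfReal_apply,
    hermiteFunction_apply_zero, Complex.conj_ofReal, ← Complex.ofReal_mul]
  obtain ⟨l, rfl | rfl⟩ := n.even_or_odd'
  · have h1 : (-Complex.I) ^ (2 * l) = (((-1) ^ l : ℝ) : ℂ) := by
      rw [Even.neg_pow (even_two_mul l), I_pow_two_mul]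
    have h2 : √(2 * Real.pi) = √2 * √(√Real.pi) ^ 2 := by
      rw [Real.sq_sqrt (Real.sqrt_nonneg _), Real.sqrt_mul zero_le_two]
    have h3 : √(2 ^ (2 * l) * (2 * l)! * √Real.pi) ^ 2 = 2 ^ (2 * l) * (2 * l)! * √(√Real.pi) ^ 2 := by
      rw [Real.sq_sqrt (by positivity), Real.sq_sqrt (Real.sqrt_nonneg _)]
    have h4 : √(2 ^ (2 * l) * (2 * l)! * √Real.pi) ≠ 0 := by positivity
    have h5 : √(√Real.pi) ≠ 0 := by positivity
    have h6 : (1 / √(2 ^ (2 * l) * (2 * l)! * √Real.pi)) ^ 2 * √(2 * Real.pi) =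
        √2 / (2 ^ (2 * l) * (2 * l)!) := by
      rw [div_pow, h3, h2]; field_simp
    rw [h1, I_pow_two_mul, Complex.ofReal_re]
    have : ∀ a b c d e f g : ℝ, g * (a * b * (c * d)) * (a * e) = (a ^ 2 * c) * (g * b * d * e) := by
      intros; ring
    rw [this _ _ _ _ _ 0, h6]
    push_cast
    ring
  · simp [eval_physHermite_odd_zero]

/-- `Im(i^n)` vanishes for even `n` and `H_n(0)` for odd `n`. -/
theorem sin_delta_term (n : ℕ) :
    (starRingEnd ℂ) (sinDistribution (schwartzOfReal (hermiteFunction n))) *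
        TemperedDistribution.delta 0 (schwartzOfReal (hermiteFunction n)) = 0 := by
  rw [sinDistribution_hermiteFunction, TemperedDistribution.delta_apply, schwartzOfReal_apply,
    hermiteFunction_apply_zero]
  obtain ⟨l, rfl | rfl⟩ := n.even_or_odd'
  · rw [I_pow_two_mul, Complex.ofReal_im]; simp
  · simp [eval_physHermite_odd_zero]

theorem mainTheorem7 :
    -- the values of `cos` on the Hermite functions
    (∀ l : ℕ, cosDistribution (schwartzOfReal (hermiteFunction (2 * l + 1))) = 0) ∧
    (∀ l : ℕ, cosDistribution (schwartzOfReal (hermiteFunction (2 * l))) =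
      ((√(√Real.pi / ((2 : ℝ) ^ (2 * (l : ℤ) - 1) * (2 * l)! * Real.exp 1)) * (-1) ^ l *
        (physHermite (2 * l)).eval 1 : ℝ) : ℂ)) ∧
    -- the Hermite series at the points `1` and `0`
    Tendsto (fun N : ℕ => ∑ l ∈ Finset.range N,
        (-Complex.I) ^ l / ((2 : ℂ) ^ l * (l ! : ℂ)) *
          (((physHermite l).eval 1 * (physHermite l).eval 0 : ℝ) : ℂ))
      atTop (𝓝 ((√(Real.exp 1 / 2) : ℝ) : ℂ)) ∧
    -- the `e`-product of `cos` and `δ` exists, equals `1`, and agrees with `∫ cos(x) δ(x) dx`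
    HasEProduct hermiteFunction cosDistribution (TemperedDistribution.delta 0) 1 ∧
    (∫ x : ℝ, (Real.cos x : ℂ) ∂(Measure.dirac 0)) = 1 ∧
    -- the `e`-product of `sin` and `δ` exists, equals `0`, and agrees with `∫ sin(x) δ(x) dx`
    HasEProduct hermiteFunction sinDistribution (TemperedDistribution.delta 0) 0 ∧
    (∫ x : ℝ, (Real.sin x : ℂ) ∂(Measure.dirac 0)) = 0 := by
  refine ⟨fun l => ?_, fun l => ?_, tendsto_hermite_series, ?_, by simp, ?_, by simp⟩
  · rw [cosDistribution_hermiteFunction, I_pow_two_mul_succ_re]; simp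
  · rw [cosDistribution_hermiteFunction, I_pow_two_mul, Complex.ofReal_re,
      ← one_div_sqrt_mul_sqrt_two_pi]
    congr 1
    ring
  · have h := tendsto_hermite_series.const_mul ((√2 * Real.exp (-1 / 2) : ℝ) : ℂ)
    -- The common factor of the terms is exactly the reciprocal of the series' sum.
    have e : √2 * Real.exp (-1 / 2) * √(Real.exp 1 / 2) = 1 := by
      rw [Real.sqrt_div (Real.exp_pos 1).le, ← Real.exp_half]
      have h2 : √2 ≠ 0 := by positivity
      field_simp
      rw [← Real.exp_add]
      norm_num
    rw [← Complex.ofReal_mul, e, Complex.ofReal_one] at h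
    simpa only [HasEProduct, cos_delta_term, ← Finset.mul_sum] using h
  · simp only [HasEProduct, sin_delta_term, Finset.sum_const_zero]
    exact tendsto_const_nhds
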